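/- Let $\mathbb D=\{z\in\mathbb C:|z|<1\}$, and let $\omega$ be the hyperbolic distance of $\mathbb D$, i.e. $\omega(z,w)=\inf_\gamma\int_0^1\frac{|\gamma'(s)|}{1-|\gamma(s)|^2}\,ds$, the infimum being over all Lipschitz curves $\gamma:[0,1]\to\mathbb D$ with $\gamma(0)=z$, $\gamma(1)=w$. A non-elliptic semigroup in $\mathbb D$ is a family $(\phi_t)_{t\ge 0}$ of holomorphic maps $\phi_t:\mathbb D\to\mathbb D$ such that $\phi_0=\mathrm{id}$, $\phi_{t+s}=\phi_t\circ\phi_s$ for all $t,s\ge0$, $t\mapsto\phi_t$ is continuous on $[0,+\infty)$ for uniform convergence on compact subsets of $\mathbb D$, and $\phi_t$ has no fixed point in $\mathbb D$ for $t>0$. Its total speed is $v(t):=\omega(0,\phi_t(0))$. A holomorphic model of $(\phi_t)$ is given by an injective holomorphic $h:\mathbb D\to\mathbb C$ with $h(\mathbb D)+it\subseteq h(\mathbb D)$ and $h(\phi_t(z))=h(z)+it$ for all $t\ge 0$, $z\in\mathbb D$, normalized so that $\Omega:=\bigcup_{t\ge0}(h(\mathbb D)-it)$ is a strip $\{0<\operatorname{Re}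 z<r\}$ with $r>0$, the half-plane $\{\operatorname{Re} z>0\}$, the half-plane $\{\operatorname{Re} z<0\}$, or $\mathbb C$. The semigroup is parabolic if $\Omega$ is not a strip, and parabolic of zero hyperbolic step if $\Omega=\mathbb C$. Let $g:[0,+\infty)\to[0,+\infty)$ be a function such that $\lim_{t\to+\infty}g(t)=+\infty$ and $\lim_{t\to+\infty}g(t)/t=0$. Then there exists a parabolic semigroup $(\phi_t)$ in $\mathbb D$ of zero hyperbolic step such that $$\limsup_{t\to+\infty}\frac{v(t)}{g(t)}=+\infty .$$ -/

import Mathlib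

open Set Filter Topology Metric

/-- Admissible curves for the hyperbolic distance: curves `[0,1] → 𝔻`, Lipschitz continuous,
joining `z` to `w`. Here `𝔻` is `ball (0 : ℂ) 1`. -/
structure IsDiscCurve (γ : ℝ → ℂ) (z w : ℂ) : Prop where
  lipschitz : ∃ K, LipschitzOnWith K γ (Icc 0 1)
  mapsTo : MapsTo γ (Icc 0 1) (ball (0 : ℂ) 1)
  source : γ 0 = z
  target : γ 1 = w

/-- The hyperbolic norm `|v| / (1 - |z|²)` of the vector `v` at the point `z` of the unit disc. -/
noncomputable def hyperbolicNorm (z v : ℂ) : ℝ := ‖v‖ / (1 - ‖z‖ ^ 2)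

/-- The hyperbolic length of a Lipschitz curve `γ : [0,1] → 𝔻` (which is differentiable a.e.). -/
noncomputable def hyperbolicLength (γ : ℝ → ℂ) : ℝ :=
  ∫ s in (0 : ℝ)..1, hyperbolicNorm (γ s) (deriv γ s)

/-- The hyperbolic distance of the unit disc: the infimum of the hyperbolic lengths of the
Lipschitz curves in the disc joining the two points. -/
noncomputable def hyperbolicDist (z w : ℂ) : ℝ :=
  sInf {L : ℝ | ∃ γ : ℝ → ℂ, IsDiscCurve γ z w ∧ hyperbolicLength γ = L}

/-- Continuous non-elliptic semigroups `(φ_t)_{t ≥ 0}` of holomorphic self-maps of the unit disc.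
Only the values `φ t z` with `0 ≤ t` and `‖z‖ < 1` matter. -/
structure IsNonEllipticSemigroup (φ : ℝ → ℂ → ℂ) : Prop where
  mapsTo : ∀ t, 0 ≤ t → MapsTo (φ t) (ball (0 : ℂ) 1) (ball (0 : ℂ) 1)
  holomorphic : ∀ t, 0 ≤ t → DifferentiableOn ℂ (φ t) (ball (0 : ℂ) 1)
  zero : ∀ z ∈ ball (0 : ℂ) 1, φ 0 z = z
  add : ∀ t s, 0 ≤ t → 0 ≤ s → ∀ z ∈ ball (0 : ℂ) 1, φ (t + s) z = φ t (φ s z)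
  continuous : ∀ t₀, 0 ≤ t₀ → ∀ K, K ⊆ ball (0 : ℂ) 1 → IsCompact K →
    TendstoUniformlyOn φ (φ t₀) (𝓝[Ici 0] t₀) K
  noFixedPoint : ∀ t, 0 < t → ∀ z ∈ ball (0 : ℂ) 1, φ t z ≠ z

/-- The vertical strip `{0 < Re z < r}`. -/
def verticalStrip (r : ℝ) : Set ℂ := {z | 0 < z.re ∧ z.re < r}

/-- `(Ω, h, z ↦ z + i t)` is the (normalized) holomorphic model of the semigroup `φ`. -/
structure IsHolomorphicModel (φ : ℝ → ℂ → ℂ) (Ω : Set ℂ) (h : ℂ → ℂ) : Prop where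
  holomorphic : DifferentiableOn ℂ h (ball (0 : ℂ) 1)
  injective : InjOn h (ball (0 : ℂ) 1)
  starlikeAtInfinity : ∀ t : ℝ, 0 ≤ t → ∀ w ∈ h '' ball (0 : ℂ) 1,
    w + Complex.I * t ∈ h '' ball (0 : ℂ) 1
  semiconj : ∀ t : ℝ, 0 ≤ t → ∀ z ∈ ball (0 : ℂ) 1, h (φ t z) = h z + Complex.I * t
  base_eq : Ω = ⋃ t ∈ Ici (0 : ℝ), (fun w : ℂ => w - Complex.I * t) '' (h '' ball (0 : ℂ) 1)
  base_cases : (∃ r, 0 < r ∧ Ω = verticalStrip r) ∨ Ω = {z | 0 < z.re} ∨ Ω = {z | z.re < 0} ∨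
    Ω = univ

/-- A non-elliptic semigroup is parabolic if the base space of its holomorphic model is not
a strip. -/
def IsParabolicSemigroup (φ : ℝ → ℂ → ℂ) : Prop :=
  IsNonEllipticSemigroup φ ∧
    ∃ Ω h, IsHolomorphicModel φ Ω h ∧ ¬ ∃ r, 0 < r ∧ Ω = verticalStrip r

/-- The hyperbolic step is zero if the base space of the holomorphic model is `ℂ`. -/
def HasZeroHyperbolicStep (φ : ℝ → ℂ → ℂ) : Prop :=
  ∃ h, IsHolomorphicModel φ univ h

/-- The total speed `v(t) = ω(0, φ_t(0))`. -/
noncomputable def totalSpeed (φ : ℝ → ℂ → ℂ) (t : ℝ) : ℝ := hyperbolicDist 0 (φ t 0)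

/-! The semigroup is conjugate to vertical translations by `h = i F((1 + z) / (1 - z))`, where `F(w)
= ∑ log (1 + w / b k)` on the right half-plane, `b 0 = 1` and `b` grows very fast.

Since `F' = ∑ (b k + w)⁻¹` has positive real part, `F` is injective. A continuity argument shows
that its image is stable under translation by positive reals (`logSeries_add_mem_image`). Each of
the infinitely many logarithms contributes a definite angle high up in the half-plane, so `Im F`
takes every real value and the translated images fill the plane (`exists_add_mem_image_logSeries`):
the hyperbolic step is zero.

The orbit of `0` corresponds to the ray `x ≥ 1`, at time `t = F(x) - F(1)`, and `v(t) ≥ log x / 2`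
(`half_log_le_totalSpeed`). As only the `b k` up to about `x` matter, `t` is roughly at most `log x`
times their number. The `b k` can be spaced so widely that, at suitable points `x n`, this number is
`n + 1` while `g(t) ≤ t / (n + 2)²`. Then `v(t) / g(t)` is at least of order `n`
(`exists_slow_log_series`). -/

/-! ### Lower bound for the hyperbolic distance -/

theorem hasDerivAt_half_log_ratio {u : ℝ} (h₁ : -1 < u) (h₂ : u < 1) :
    HasDerivAt (fun u : ℝ => (Real.log (1 + u) - Real.log (1 - u)) / 2) (1 / (1 - u ^ 2)) u := by
  have e₁ : HasDerivAt (fun u : ℝ => Real.log (1 + u)) (1 / (1 + u)) u :=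
    ((hasDerivAt_id u).const_add 1).log (by simp only [id]; linarith)
  have e₂ : HasDerivAt (fun u : ℝ => Real.log (1 - u)) (-1 / (1 - u)) u :=
    ((hasDerivAt_id u).const_sub 1).log (by simp only [id]; linarith)
  have h₃ : 1 + u ≠ 0 := by linarith
  have h₄ : 1 - u ≠ 0 := by linarith
  have h₅ : 1 - u ^ 2 ≠ 0 := by
    rw [show 1 - u ^ 2 = (1 + u) * (1 - u) by ring]; exact mul_ne_zero h₃ h₄
  refine ((e₁.sub e₂).div_const 2).congr_deriv ?_
  field_simp
  ring

theorem IsDiscCurve.exists_norm_le {γ : ℝ → ℂ} {z w : ℂ} (h : IsDiscCurve γ z w) :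
    ∃ r, 0 ≤ r ∧ r < 1 ∧ ∀ s ∈ Icc (0 : ℝ) 1, ‖γ s‖ ≤ r := by
  obtain ⟨K, hK⟩ := h.lipschitz
  obtain ⟨s₀, hs₀, hmax⟩ := isCompact_Icc.exists_isMaxOn (nonempty_Icc.2 zero_le_one)
    hK.continuousOn.norm
  refine ⟨‖γ s₀‖, norm_nonneg _, by simpa using h.mapsTo hs₀, fun s hs => hmax hs⟩

theorem one_sub_sq_pos_of_norm_le {z : ℂ} {r : ℝ} (hr : r < 1) (hz : ‖z‖ ≤ r) :
    1 - r ^ 2 ≤ 1 - ‖z‖ ^ 2 ∧ 0 < 1 - ‖z‖ ^ 2 := by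
  have := norm_nonneg z
  constructor <;> nlinarith

theorem IsDiscCurve.intervalIntegrable {γ : ℝ → ℂ} {z w : ℂ} (h : IsDiscCurve γ z w) :
    IntervalIntegrable (fun s => hyperbolicNorm (γ s) (deriv γ s)) MeasureTheory.volume 0 1 := by
  obtain ⟨r, hr₀, hr₁, hr⟩ := h.exists_norm_le
  obtain ⟨K, hK⟩ := h.lipschitz
  rw [intervalIntegrable_iff_integrableOn_Ioo_of_le zero_le_one]
  refine ⟨?_, .restrict_of_bounded (C := K / (1 - r ^ 2)) measure_Ioo_lt_top ?_⟩
  · have h₁ : AEMeasurable γ (MeasureTheory.volume.restrict (Ioo (0 : ℝ) 1)) :=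
      (hK.continuousOn.mono Ioo_subset_Icc_self).aemeasurable measurableSet_Ioo
    have h₂ : AEMeasurable (deriv γ) (MeasureTheory.volume.restrict (Ioo (0 : ℝ) 1)) :=
      (measurable_deriv γ).aemeasurable
    exact (h₂.norm.div ((h₁.norm.pow_const 2).const_sub 1)).aestronglyMeasurable
  · rw [MeasureTheory.ae_restrict_iff' measurableSet_Ioo]
    refine .of_forall fun s hs => ?_
    obtain ⟨h₁, h₂⟩ := one_sub_sq_pos_of_norm_le hr₁ (hr s (Ioo_subset_Icc_self hs))
    have h₃ : ‖deriv γ s‖ ≤ K := norm_deriv_le_of_lipschitzOn (Icc_mem_nhds hs.1 hs.2) hK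
    rw [hyperbolicNorm, Real.norm_of_nonneg (by positivity)]
    exact div_le_div₀ K.2 h₃ (by nlinarith) h₁

/-- Projection to the real diameter does not increase length: with `u = Re γ`, the integrand `|γ'| /
(1 - |γ|²)` dominates `u' / (1 - u²)`, the derivative of `artanh u`. -/
theorem IsDiscCurve.le_hyperbolicLength {γ : ℝ → ℂ} {z w : ℂ} (h : IsDiscCurve γ z w) :
    (Real.log (1 + w.re) - Real.log (1 - w.re)) / 2 -
      (Real.log (1 + z.re) - Real.log (1 - z.re)) / 2 ≤ hyperbolicLength γ := by
  obtain ⟨r, hr₀, hr₁, hr⟩ := h.exists_norm_le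
  obtain ⟨K, hK⟩ := h.lipschitz
  set P : ℝ → ℝ := fun u => (Real.log (1 + u) - Real.log (1 - u)) / 2
  have hre : ∀ s ∈ Icc (0 : ℝ) 1, (γ s).re ∈ Icc (-r) r := fun s hs =>
    abs_le.1 ((Complex.abs_re_le_norm _).trans (hr s hs))
  have hPlip : LipschitzOnWith (Real.toNNReal (1 / (1 - r ^ 2))) P (Icc (-r) r) := by
    refine (convex_Icc (-r) r).lipschitzOnWith_of_nnnorm_hasDerivWithin_le
      (f' := fun u => 1 / (1 - u ^ 2))
      (fun u hu => (hasDerivAt_half_log_ratio (by linarith [hu.1])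
        (by linarith [hu.2])).hasDerivWithinAt) fun u hu => ?_
    have h₁ : 0 < 1 - r ^ 2 := by nlinarith
    have h₂ : 1 - r ^ 2 ≤ 1 - u ^ 2 := by nlinarith [hu.1, hu.2]
    rw [← NNReal.coe_le_coe, Real.coe_toNNReal _ (by positivity), coe_nnnorm,
      Real.norm_of_nonneg (div_nonneg zero_le_one (h₁.le.trans h₂))]
    exact one_div_le_one_div_of_le h₁ h₂
  have hrelip : LipschitzOnWith (1 * K) (fun s => (γ s).re) (Icc 0 1) := by
    refine LipschitzWith.comp_lipschitzOnWith (f := Complex.re) ?_ hK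
    refine LipschitzWith.of_dist_le_mul fun x y => ?_
    simpa [dist_eq_norm] using Complex.abs_re_le_norm (x - y)
  -- The curve is differentiable only almost everywhere, so the fundamental theorem of calculus is
  -- used in its absolutely continuous form.
  have hac : AbsolutelyContinuousOnInterval (fun s => P (γ s).re) 0 1 := by
    apply LipschitzOnWith.absolutelyContinuousOnInterval
    rw [uIcc_of_le zero_le_one]
    exact hPlip.comp hrelip hre
  have hint := hac.integral_deriv_eq_sub
  simp only [h.source, h.target] at hint
  rw [hyperbolicLength, ← hint]
  refine intervalIntegral.integral_mono_ae_restrict zero_le_one hac.intervalIntegrable_deriv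
    h.intervalIntegrable ?_
  rw [← MeasureTheory.Measure.restrict_congr_set MeasureTheory.Ioo_ae_eq_Icc, Filter.EventuallyLE,
    MeasureTheory.ae_restrict_iff' measurableSet_Ioo]
  filter_upwards [hK.ae_differentiableWithinAt_of_mem (μ := MeasureTheory.volume)] with s hs hs'
  have hsI := Ioo_subset_Icc_self hs'
  have hd : HasDerivAt γ (deriv γ s) s :=
    ((hs hsI).differentiableAt (Icc_mem_nhds hs'.1 hs'.2)).hasDerivAt
  have hd' : HasDerivAt (fun s => (γ s).re) (deriv γ s).re s :=
    Complex.reCLM.hasFDerivAt.comp_hasDerivAt s hd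
  have hu := hre s hsI
  have hd'' : HasDerivAt (fun s => P (γ s).re) (1 / (1 - (γ s).re ^ 2) * (deriv γ s).re) s :=
    (hasDerivAt_half_log_ratio (by linarith [hu.1]) (by linarith [hu.2])).comp s hd'
  rw [hd''.deriv, hyperbolicNorm, one_div, inv_mul_eq_div]
  obtain ⟨-, h₂⟩ := one_sub_sq_pos_of_norm_le hr₁ (hr s hsI)
  have h₃ := (Complex.abs_re_le_norm (γ s))
  refine div_le_div₀ (norm_nonneg _) ((le_abs_self _).trans (Complex.abs_re_le_norm _)) h₂ ?_
  have := sq_le_sq' (by linarith [neg_abs_le (γ s).re, norm_nonneg (γ s)])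
    ((le_abs_self _).trans h₃)
  linarith

theorem exists_isDiscCurve {z w : ℂ} (hz : z ∈ ball (0 : ℂ) 1) (hw : w ∈ ball (0 : ℂ) 1) :
    ∃ γ, IsDiscCurve γ z w := by
  refine ⟨AffineMap.lineMap z w, ⟨?_, fun s hs => ?_, by simp, by simp⟩⟩
  · exact ⟨_, (lipschitzWith_lineMap z w).lipschitzOnWith⟩
  · exact (convex_ball (0 : ℂ) 1).lineMap_mem hz hw hs

theorem le_hyperbolicDist {z w : ℂ} (hz : z ∈ ball (0 : ℂ) 1) (hw : w ∈ ball (0 : ℂ) 1) :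
    (Real.log (1 + w.re) - Real.log (1 - w.re)) / 2 -
      (Real.log (1 + z.re) - Real.log (1 - z.re)) / 2 ≤ hyperbolicDist z w := by
  obtain ⟨γ, hγ⟩ := exists_isDiscCurve hz hw
  refine le_csInf ⟨_, γ, hγ, rfl⟩ ?_
  rintro L ⟨γ, hγ, rfl⟩
  exact hγ.le_hyperbolicLength

/-! ### Semigroups built from a Koenigs map -/

/-- The conjugates of the vertical translations by `h`. -/
noncomputable def translationSemigroup (h : ℂ → ℂ) (t : ℝ) (z : ℂ) : ℂ :=
  Function.invFunOn h (ball 0 1) (h z + Complex.I * t)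

/-- A univalent function on the unit disc whose image is stable under upward translations. -/
structure IsKoenigsMap (h : ℂ → ℂ) : Prop where
  holomorphic : DifferentiableOn ℂ h (ball (0 : ℂ) 1)
  injective : InjOn h (ball (0 : ℂ) 1)
  deriv_ne_zero : ∀ z ∈ ball (0 : ℂ) 1, deriv h z ≠ 0
  starlike : ∀ t : ℝ, 0 ≤ t → ∀ w ∈ h '' ball (0 : ℂ) 1, w + Complex.I * t ∈ h '' ball (0 : ℂ) 1

namespace IsKoenigsMap

variable {h : ℂ → ℂ}

theorem map_nhds_eq (H : IsKoenigsMap h) {z : ℂ} (hz : z ∈ ball (0 : ℂ) 1) :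
    map h (𝓝 z) = 𝓝 (h z) :=
  HasStrictDerivAt.map_nhds_eq
    (H.holomorphic.analyticAt (isOpen_ball.mem_nhds hz)).hasStrictDerivAt (H.deriv_ne_zero z hz)

theorem invFunOn_apply (H : IsKoenigsMap h) {z : ℂ} (hz : z ∈ ball (0 : ℂ) 1) :
    Function.invFunOn h (ball 0 1) (h z) = z :=
  H.injective.leftInvOn_invFunOn hz

theorem hasDerivAt_invFunOn (H : IsKoenigsMap h) {z : ℂ} (hz : z ∈ ball (0 : ℂ) 1) :
    HasDerivAt (Function.invFunOn h (ball 0 1)) (deriv h z)⁻¹ (h z) := by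
  have hball : ball (0 : ℂ) 1 ∈ 𝓝 z := isOpen_ball.mem_nhds hz
  have hcont : ContinuousAt (Function.invFunOn h (ball 0 1)) (h z) := by
    rw [ContinuousAt, H.invFunOn_apply hz, ← H.map_nhds_eq hz, tendsto_map'_iff]
    refine tendsto_id.congr' ?_
    filter_upwards [hball] with y hy using (H.invFunOn_apply hy).symm
  refine HasDerivAt.of_local_left_inverse (f := h) hcont ?_ (H.deriv_ne_zero z hz) ?_
  · rw [H.invFunOn_apply hz]
    exact (H.holomorphic.differentiableAt hball).hasDerivAt
  · rw [← H.map_nhds_eq hz, eventually_map]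
    filter_upwards [hball] with y hy using by rw [H.invFunOn_apply hy]

theorem mapsTo (H : IsKoenigsMap h) {t : ℝ} (ht : 0 ≤ t) {z : ℂ} (hz : z ∈ ball (0 : ℂ) 1) :
    translationSemigroup h t z ∈ ball (0 : ℂ) 1 :=
  Function.invFunOn_mem (H.starlike t ht _ (mem_image_of_mem h hz))

theorem semiconj (H : IsKoenigsMap h) {t : ℝ} (ht : 0 ≤ t) {z : ℂ} (hz : z ∈ ball (0 : ℂ) 1) :
    h (translationSemigroup h t z) = h z + Complex.I * t :=
  Function.invFunOn_eq (H.starlike t ht _ (mem_image_of_mem h hz))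

theorem translationSemigroup_eq (H : IsKoenigsMap h) {t : ℝ} {z w : ℂ}
    (hw : w ∈ ball (0 : ℂ) 1) (hzw : h w = h z + Complex.I * t) :
    translationSemigroup h t z = w := by
  rw [translationSemigroup, ← hzw, H.invFunOn_apply hw]

theorem hasDerivAt_invFunOn_translate (H : IsKoenigsMap h) {t : ℝ} (ht : 0 ≤ t) {z : ℂ}
    (hz : z ∈ ball (0 : ℂ) 1) :
    HasDerivAt (Function.invFunOn h (ball 0 1)) (deriv h (translationSemigroup h t z))⁻¹
      (h z + Complex.I * t) := by
  have := H.hasDerivAt_invFunOn (H.mapsTo ht hz)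
  rwa [H.semiconj ht hz] at this

theorem continuousOn_uncurry (H : IsKoenigsMap h) :
    ContinuousOn (Function.uncurry (translationSemigroup h)) (Ici (0 : ℝ) ×ˢ ball (0 : ℂ) 1) := by
  rintro ⟨t, z⟩ ⟨ht, hz⟩
  have h₁ := (H.hasDerivAt_invFunOn_translate ht hz).continuousAt
  have h₂ : ContinuousAt (fun p : ℝ × ℂ => h p.2 + Complex.I * p.1) (t, z) := by
    refine ContinuousAt.add (ContinuousAt.comp (f := Prod.snd) (g := h) ?_ continuousAt_snd) ?_
    · exact (H.holomorphic.differentiableAt (isOpen_ball.mem_nhds hz)).continuousAt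
    · fun_prop
  exact (ContinuousAt.comp (f := fun p : ℝ × ℂ => h p.2 + Complex.I * p.1) h₁ h₂).continuousWithinAt

theorem isNonEllipticSemigroup (H : IsKoenigsMap h) :
    IsNonEllipticSemigroup (translationSemigroup h) where
  mapsTo t ht z hz := H.mapsTo ht hz
  holomorphic t ht z hz := by
    have h₁ := (H.hasDerivAt_invFunOn_translate ht hz).differentiableAt
    have h₂ : DifferentiableAt ℂ (fun z => h z + Complex.I * t) z :=
      (H.holomorphic.differentiableAt (isOpen_ball.mem_nhds hz)).add_const _
    exact (DifferentiableAt.comp (f := fun z => h z + Complex.I * t) z h₁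
      h₂).differentiableWithinAt
  zero z hz := H.translationSemigroup_eq hz (by simp)
  add t s ht hs z hz := by
    refine H.translationSemigroup_eq (H.mapsTo ht (H.mapsTo hs hz)) ?_
    rw [H.semiconj ht (H.mapsTo hs hz), H.semiconj hs hz]
    push_cast
    ring
  continuous t₀ ht₀ K hK hKc := by
    intro u hu
    -- Joint continuity in `(t, z)` and compactness of `K` give uniformity in `z`.
    obtain ⟨v, hv, hv'⟩ := hKc.mem_uniformity_of_prod
      (H.continuousOn_uncurry.mono (prod_mono_right hK)) (mem_Ici.2 ht₀) (UniformSpace.symm hu)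
    filter_upwards [hv] with t ht z hz using hv' t ht z hz
  noFixedPoint t ht z hz hfix := by
    have := H.semiconj ht.le hz
    rw [hfix, left_eq_add] at this
    simp [ht.ne'] at this

theorem isHolomorphicModel (H : IsKoenigsMap h)
    (hbase : ∀ w : ℂ, ∃ t : ℝ, 0 ≤ t ∧ w + Complex.I * t ∈ h '' ball (0 : ℂ) 1) :
    IsHolomorphicModel (translationSemigroup h) univ h where
  holomorphic := H.holomorphic
  injective := H.injective
  starlikeAtInfinity := H.starlike
  semiconj _ ht _ hz := H.semiconj ht hz
  base_eq := by
    refine (eq_univ_of_forall fun w => ?_).symm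
    obtain ⟨t, ht, hw⟩ := hbase w
    exact mem_iUnion₂.2 ⟨t, ht, _, hw, by ring⟩
  base_cases := by simp

theorem isParabolicSemigroup (H : IsKoenigsMap h)
    (hbase : ∀ w : ℂ, ∃ t : ℝ, 0 ≤ t ∧ w + Complex.I * t ∈ h '' ball (0 : ℂ) 1) :
    IsParabolicSemigroup (translationSemigroup h) := by
  refine ⟨H.isNonEllipticSemigroup, univ, h, H.isHolomorphicModel hbase, ?_⟩
  rintro ⟨r, -, hr⟩
  have : (0 : ℂ) ∈ verticalStrip r := hr ▸ mem_univ _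
  exact lt_irrefl _ this.1

end IsKoenigsMap

/-! ### Derivatives with positive real part on the half-plane -/

/-- The open right half-plane. -/
def rightHalfPlane : Set ℂ := {w | 0 < w.re}

theorem isOpen_rightHalfPlane : IsOpen rightHalfPlane :=
  isOpen_lt continuous_const Complex.continuous_re

theorem convex_rightHalfPlane : Convex ℝ rightHalfPlane := convex_halfSpace_re_gt 0

/-- A function whose derivative has positive real part on the right half-plane has difference
quotients with positive real part. -/
theorem exists_sub_eq_mul_of_re_deriv_pos {F F' : ℂ → ℂ}
    (hF : ∀ w ∈ rightHalfPlane, HasDerivAt F (F' w) w) (hF' : ∀ w ∈ rightHalfPlane, 0 < (F' w).re)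
    {w₁ w₂ : ℂ} (h₁ : w₁ ∈ rightHalfPlane) (h₂ : w₂ ∈ rightHalfPlane) :
    ∃ M : ℂ, 0 < M.re ∧ F w₂ - F w₁ = (w₂ - w₁) * M := by
  rcases eq_or_ne w₁ w₂ with rfl | hne
  · exact ⟨1, by simp, by simp⟩
  have hd : w₂ - w₁ ≠ 0 := sub_ne_zero.2 hne.symm
  refine ⟨(F w₂ - F w₁) / (w₂ - w₁), ?_, (mul_div_cancel₀ _ hd).symm⟩
  have hmem : ∀ s ∈ Icc (0 : ℝ) 1, w₁ + s * (w₂ - w₁) ∈ rightHalfPlane := fun s hs => by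
    simpa using convex_rightHalfPlane.add_smul_sub_mem h₁ h₂ hs
  have hder : ∀ s ∈ Icc (0 : ℝ) 1, HasDerivAt
      (fun s : ℝ => (F (w₁ + s * (w₂ - w₁)) / (w₂ - w₁)).re) (F' (w₁ + s * (w₂ - w₁))).re s := by
    intro s hs
    have e₁ : HasDerivAt (fun s : ℂ => w₁ + s * (w₂ - w₁)) (w₂ - w₁) (s : ℂ) := by
      simpa using ((hasDerivAt_id (s : ℂ)).mul_const (w₂ - w₁)).const_add w₁
    have e₂ := (HasDerivAt.comp (s : ℂ) (hF _ (hmem s hs)) e₁).div_const (w₂ - w₁)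
    rw [mul_div_cancel_right₀ _ hd] at e₂
    exact e₂.real_of_complex
  -- The mean value theorem applies because only the real part of the quotient is followed along the
  -- segment.
  obtain ⟨s, hs, hs'⟩ := exists_hasDerivAt_eq_slope
    (fun s : ℝ => (F (w₁ + s * (w₂ - w₁)) / (w₂ - w₁)).re) _ zero_lt_one
    (fun s hs => (hder s hs).continuousAt.continuousWithinAt)
    (fun s hs => hder s (Ioo_subset_Icc_self hs))
  have := hF' _ (hmem s (Ioo_subset_Icc_self hs))
  rw [hs'] at this
  simpa [sub_div] using this

/-! ### The logarithmic series and the translation invariance of its image -/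

/-- The function `∑ log (1 + w / bₖ)`. -/
noncomputable def logSeries (b : ℕ → ℝ) (w : ℂ) : ℂ := ∑' k, Complex.log (1 + w / b k)

theorem one_le_re_one_add_div {b : ℝ} (hb : 1 ≤ b) {w : ℂ} (hw : w ∈ rightHalfPlane) :
    1 ≤ (1 + w / b).re := by
  have : 0 < w.re := hw
  rw [Complex.add_re, Complex.one_re, Complex.div_ofReal_re]
  have : 0 ≤ w.re / b := by positivity
  linarith

theorem hasDerivAt_log_one_add_div {b : ℝ} (hb : 1 ≤ b) {w : ℂ} (hw : w ∈ rightHalfPlane) :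
    HasDerivAt (fun w : ℂ => Complex.log (1 + w / b)) (b + w)⁻¹ w := by
  have h₁ := one_le_re_one_add_div hb hw
  have h₀ : (b : ℂ) ≠ 0 := Complex.ofReal_ne_zero.2 (by linarith)
  have h₂ : HasDerivAt (fun w : ℂ => 1 + w / b) (1 / b) w :=
    ((hasDerivAt_id w).div_const (b : ℂ)).const_add 1
  refine (h₂.clog (Or.inl (by linarith))).congr_deriv ?_
  have : (b : ℂ) + w ≠ 0 := fun h => by
    have := congrArg Complex.re h
    have hw' : 0 < w.re := hw
    simp at this
    linarith
  field_simp

theorem norm_inv_add_le {b : ℝ} (hb : 1 ≤ b) {w : ℂ} (hw : w ∈ rightHalfPlane) :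
    ‖((b : ℂ) + w)⁻¹‖ ≤ 1 / b := by
  have hw' : 0 < w.re := hw
  rw [norm_inv, inv_eq_one_div]
  refine one_div_le_one_div_of_le (by linarith) ?_
  have := (le_abs_self _).trans (Complex.abs_re_le_norm ((b : ℂ) + w))
  simp at this
  linarith

theorem log_one_add_div_bounds {b x : ℝ} (hb : 1 ≤ b) (hx : 0 ≤ x) :
    0 ≤ Real.log (1 + x / b) ∧ Real.log (1 + x / b) ≤ x * (1 / b) := by
  have h : 0 ≤ x / b := by positivity
  refine ⟨Real.log_nonneg (by linarith), ?_⟩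
  have := Real.log_le_sub_one_of_pos (show 0 < 1 + x / b by linarith)
  rw [mul_one_div]
  linarith

section LogSeries

variable {b : ℕ → ℝ}

theorem summable_real_log (hb : ∀ k, 1 ≤ b k) (hs : Summable fun k => 1 / b k) {x : ℝ}
    (hx : 0 ≤ x) : Summable fun k => Real.log (1 + x / b k) :=
  Summable.of_nonneg_of_le (fun k => (log_one_add_div_bounds (hb k) hx).1)
    (fun k => (log_one_add_div_bounds (hb k) hx).2) (hs.mul_left x)

theorem complex_log_one_add_div_ofReal {c x : ℝ} (hc : 1 ≤ c) (hx : 0 ≤ x) :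
    Complex.log (1 + x / c) = (Real.log (1 + x / c) : ℝ) := by
  rw [Complex.ofReal_log (by positivity)]
  push_cast
  rfl

theorem logSeries_ofReal (hb : ∀ k, 1 ≤ b k) {x : ℝ} (hx : 0 ≤ x) :
    logSeries b x = (∑' k, Real.log (1 + x / b k) : ℝ) := by
  rw [logSeries, Complex.ofReal_tsum]
  exact tsum_congr fun k => complex_log_one_add_div_ofReal (hb k) hx

/-- Convergence at the base point `1`; the uniform bounds `1 / b k` on the derivatives of the terms
spread it over the half-plane. -/
theorem summable_complex_log_one (hb : ∀ k, 1 ≤ b k) (hs : Summable fun k => 1 / b k) :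
    Summable fun k => Complex.log (1 + 1 / b k) := by
  refine (Complex.summable_ofReal.2 (summable_real_log hb hs zero_le_one)).congr fun k => ?_
  simpa using (complex_log_one_add_div_ofReal (hb k) zero_le_one).symm

theorem summable_complex_log (hb : ∀ k, 1 ≤ b k) (hs : Summable fun k => 1 / b k) {w : ℂ}
    (hw : w ∈ rightHalfPlane) : Summable fun k => Complex.log (1 + w / b k) :=
  summable_of_summable_hasDerivAt_of_isPreconnected
    (g := fun k w => Complex.log (1 + w / b k)) (y₀ := 1) hs isOpen_rightHalfPlane
    convex_rightHalfPlane.isPreconnected (fun k _ h => hasDerivAt_log_one_add_div (hb k) h)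
    (fun k _ h => norm_inv_add_le (hb k) h) (by simp [rightHalfPlane])
    (summable_complex_log_one hb hs) hw

theorem hasDerivAt_logSeries (hb : ∀ k, 1 ≤ b k) (hs : Summable fun k => 1 / b k) {w : ℂ}
    (hw : w ∈ rightHalfPlane) : HasDerivAt (logSeries b) (∑' k, ((b k : ℂ) + w)⁻¹) w :=
  hasDerivAt_tsum_of_isPreconnected (y₀ := 1) hs isOpen_rightHalfPlane
    convex_rightHalfPlane.isPreconnected (fun k _ h => hasDerivAt_log_one_add_div (hb k) h)
    (fun k _ h => norm_inv_add_le (hb k) h) (by simp [rightHalfPlane])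
    (summable_complex_log_one hb hs) hw

theorem re_inv_add_pos {c : ℝ} (hc : 1 ≤ c) {w : ℂ} (hw : w ∈ rightHalfPlane) :
    0 < ((c : ℂ) + w)⁻¹.re := by
  have hw' : 0 < w.re := hw
  have h : 0 < ((c : ℂ) + w).re := by simp; linarith
  rw [Complex.inv_re]
  exact div_pos h (Complex.normSq_pos.2 fun h₀ => by simp [h₀] at h)

theorem re_deriv_logSeries_pos (hb : ∀ k, 1 ≤ b k) (hs : Summable fun k => 1 / b k) {w : ℂ}
    (hw : w ∈ rightHalfPlane) : 0 < (∑' k, ((b k : ℂ) + w)⁻¹).re := by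
  have h : Summable fun k => ((b k : ℂ) + w)⁻¹ :=
    Summable.of_norm_bounded hs fun k => norm_inv_add_le (hb k) hw
  rw [Complex.re_tsum h]
  exact (Complex.reCLM.summable h).tsum_pos (fun k => (re_inv_add_pos (hb k) hw).le) 0
    (re_inv_add_pos (hb 0) hw)

theorem exists_logSeries_sub_eq_mul (hb : ∀ k, 1 ≤ b k) (hs : Summable fun k => 1 / b k)
    {w₁ w₂ : ℂ} (h₁ : w₁ ∈ rightHalfPlane) (h₂ : w₂ ∈ rightHalfPlane) :
    ∃ M : ℂ, 0 < M.re ∧ logSeries b w₂ - logSeries b w₁ = (w₂ - w₁) * M :=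
  exists_sub_eq_mul_of_re_deriv_pos (fun _ hw => hasDerivAt_logSeries hb hs hw)
    (fun _ hw => re_deriv_logSeries_pos hb hs hw) h₁ h₂

theorem injOn_logSeries (hb : ∀ k, 1 ≤ b k) (hs : Summable fun k => 1 / b k) :
    InjOn (logSeries b) rightHalfPlane := by
  intro w₁ h₁ w₂ h₂ h
  obtain ⟨M, hM, hM'⟩ := exists_logSeries_sub_eq_mul hb hs h₁ h₂
  rw [h, sub_self, eq_comm, mul_eq_zero, sub_eq_zero] at hM'
  exact (hM'.resolve_right fun h₀ => by simp [h₀] at hM).symm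

/-- Here `w₂ - w₁ = t / M` with `Re M > 0`. Hence lifted translations never approach the imaginary
axis. -/
theorem re_le_re_of_logSeries_eq_add (hb : ∀ k, 1 ≤ b k) (hs : Summable fun k => 1 / b k)
    {w₁ w₂ : ℂ} (h₁ : w₁ ∈ rightHalfPlane) (h₂ : w₂ ∈ rightHalfPlane) {t : ℝ} (ht : 0 ≤ t)
    (h : logSeries b w₂ = logSeries b w₁ + t) : w₁.re ≤ w₂.re := by
  obtain ⟨M, hM, hM'⟩ := exists_logSeries_sub_eq_mul hb hs h₁ h₂
  have hM₀ : M ≠ 0 := fun h₀ => by simp [h₀] at hM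
  have : w₂ - w₁ = t * M⁻¹ := by
    rw [eq_mul_inv_iff_mul_eq₀ hM₀, ← hM', h, add_sub_cancel_left]
  have h' := congrArg Complex.re this
  rw [Complex.re_ofReal_mul, Complex.inv_re, Complex.sub_re] at h'
  have : 0 ≤ t * (M.re / Complex.normSq M) :=
    mul_nonneg ht (div_nonneg hM.le (Complex.normSq_nonneg _))
  linarith

/-- The term `k = 0` is `log (1 + w)`, and the others have nonnegative real part. This keeps lifted
translations bounded. -/
theorem norm_one_add_le_exp_re_logSeries (hb : ∀ k, 1 ≤ b k) (hs : Summable fun k => 1 / b k)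
    (hb₀ : b 0 = 1) {w : ℂ} (hw : w ∈ rightHalfPlane) :
    ‖1 + w‖ ≤ Real.exp (logSeries b w).re := by
  have hsum := summable_complex_log hb hs hw
  have h₁ : ∀ k, 1 ≤ ‖1 + w / b k‖ := fun k =>
    (one_le_re_one_add_div (hb k) hw).trans ((le_abs_self _).trans (Complex.abs_re_le_norm _))
  have h₀ := h₁ 0
  rw [hb₀, Complex.ofReal_one, div_one] at h₀
  rw [← Real.log_le_iff_le_exp (by linarith), logSeries, Complex.re_tsum hsum]
  refine le_trans (by simp [Complex.log_re, hb₀]) ((Complex.reCLM.summable hsum).le_tsum 0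
    fun k _ => ?_)
  simpa [Complex.log_re] using Real.log_nonneg (h₁ k)

/-- Continuity method in the translation time: the set `S` of times that stay in the image is open
by the open mapping property, and closed in `[0, t]` because the preimages remain in a fixed compact
subset of the half-plane. -/
theorem logSeries_add_mem_image (hb : ∀ k, 1 ≤ b k) (hs : Summable fun k => 1 / b k)
    (hb₀ : b 0 = 1) {w : ℂ} (hw : w ∈ rightHalfPlane) {t : ℝ} (ht : 0 ≤ t) :
    logSeries b w + t ∈ logSeries b '' rightHalfPlane := by
  have hcont : ContinuousOn (logSeries b) rightHalfPlane := fun w hw =>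
    (hasDerivAt_logSeries hb hs hw).continuousAt.continuousWithinAt
  let S : Set ℝ := {s | logSeries b w + s ∈ logSeries b '' rightHalfPlane}
  have htrans : Continuous fun s : ℝ => logSeries b w + s := by fun_prop
  have hopen : IsOpen S := by
    rw [isOpen_iff_mem_nhds]
    rintro s ⟨w', hw', hs'⟩
    have hw'n := isOpen_rightHalfPlane.mem_nhds hw'
    have hdiff : DifferentiableOn ℂ (logSeries b) rightHalfPlane := fun w hw =>
      (hasDerivAt_logSeries hb hs hw).differentiableAt.differentiableWithinAt
    have hne : (∑' k, ((b k : ℂ) + w')⁻¹) ≠ 0 := fun h => by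
      simpa [h] using re_deriv_logSeries_pos hb hs hw'
    have hmap : map (logSeries b) (𝓝 w') = 𝓝 (logSeries b w') := by
      refine HasStrictDerivAt.map_nhds_eq (hdiff.analyticAt hw'n).hasStrictDerivAt ?_
      rwa [(hasDerivAt_logSeries hb hs hw').deriv]
    refine htrans.continuousAt.preimage_mem_nhds ?_
    rw [← hs', ← hmap]
    exact image_mem_map hw'n
  have hclosed : IsClosed (S ∩ Icc 0 t) := by
    let C : Set ℂ := {w' | w.re ≤ w'.re} ∩ closedBall 0 (Real.exp ((logSeries b w).re + t) + 1)
    have hC : IsCompact C := (isCompact_closedBall _ _).inter_left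
      (isClosed_le continuous_const Complex.continuous_re)
    have hCsub : C ⊆ rightHalfPlane := fun w' h => lt_of_lt_of_le (show 0 < w.re from hw) h.1
    have himg : IsClosed (logSeries b '' C) := (hC.image_of_continuousOn (hcont.mono hCsub)).isClosed
    have heq : S ∩ Icc 0 t = (fun s : ℝ => logSeries b w + s) ⁻¹' (logSeries b '' C) ∩ Icc 0 t := by
      ext s
      refine and_congr_left fun hst => ⟨?_, fun h => image_mono hCsub h⟩
      rintro ⟨w', hw', hs'⟩
      refine ⟨w', ⟨re_le_re_of_logSeries_eq_add hb hs hw hw' hst.1 hs', ?_⟩, hs'⟩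
      have h₁ := norm_one_add_le_exp_re_logSeries hb hs hb₀ hw'
      have h₂ : Real.exp (logSeries b w').re ≤ Real.exp ((logSeries b w).re + t) := by
        rw [Real.exp_le_exp, hs']
        simpa using hst.2
      have h₃ := norm_sub_le (1 + w') 1
      rw [add_sub_cancel_left, norm_one] at h₃
      rw [mem_closedBall_zero_iff]
      linarith
    rw [heq]
    exact (himg.preimage htrans).inter isClosed_Icc
  exact hclosed.Icc_subset_of_forall_mem_nhdsWithin (a := 0) (b := t)
    ⟨w, hw, by simp⟩ (fun s hs => mem_nhdsWithin_of_mem_nhds (hopen.mem_nhds hs.1))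
    (right_mem_Icc.2 ht)

end LogSeries

/-! ### Choice of the sequences `b` and `x` -/

/-- A rapidly growing sequence `b` whose series `∑ log (1 + x / bₖ)` exceeds a multiple of `log x`
so slowly that it realizes a prescribed sublinear comparison along a sequence of points. -/
theorem exists_slow_log_series {g : ℝ → ℝ} (hg_atTop : Tendsto g atTop atTop)
    (hg_div : Tendsto (fun t => g t / t) atTop (𝓝 0)) :
    ∃ (b x : ℕ → ℝ), (∀ k, 1 ≤ b k) ∧ (Summable fun k => 1 / b k) ∧ b 0 = 1 ∧ (∀ n, 1 ≤ x n) ∧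
      Tendsto (fun n => ∑' k, Real.log (1 + x n / b k) - ∑' k, Real.log (1 + 1 / b k))
        atTop atTop ∧
      ∀ n : ℕ, ∀ t, t = ∑' k, Real.log (1 + x n / b k) - ∑' k, Real.log (1 + 1 / b k) →
        0 < g t ∧ (n + 2) / 4 * g t ≤ Real.log (x n) / 2 := by
  have hS : ∀ n : ℕ, ∃ S : ℝ, n + 1 ≤ S ∧ ∀ t, S ≤ t → 0 < g t ∧ g t ≤ t / (n + 2 : ℝ) ^ 2 := by
    intro n
    have h₁ := hg_div.eventually_lt_const (show (0 : ℝ) < 1 / (n + 2 : ℝ) ^ 2 by positivity)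
    obtain ⟨A, hA⟩ := eventually_atTop.1
      ((h₁.and (hg_atTop.eventually_gt_atTop 0)).and (eventually_gt_atTop 0))
    refine ⟨max A (n + 1), le_max_right _ _, fun t ht => ?_⟩
    obtain ⟨⟨h₂, h₃⟩, h₄⟩ := hA t ((le_max_left _ _).trans ht)
    refine ⟨h₃, ?_⟩
    rw [div_lt_iff₀ h₄] at h₂
    linarith [one_div_mul_eq_div ((n + 2 : ℝ) ^ 2) t]
  choose S hS₁ hS₂ using hS
  -- The term `k = 0` alone makes the time at `x n` at least `log (x n) - log 2`; the `+ 1` absorbs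
  -- `log 2`, so that this time exceeds `S n` whatever the other `b k` are.
  let x : ℕ → ℝ := fun n => Real.exp (S n + 1)
  -- The factor `2 ^ k` ensures summability, the sum makes `x n / b k ≤ 2⁻ᵏ` for `n < k`, and the
  -- `1` gives `b 0 = 1`.
  let b : ℕ → ℝ := fun k => 2 ^ k * (1 + ∑ j ∈ Finset.range k, x j)
  have hS₀ : ∀ n, 1 ≤ S n := fun n => by
    have : (0 : ℝ) ≤ n := n.cast_nonneg
    linarith [hS₁ n]
  have hx₁ : ∀ n, 1 ≤ x n := fun n => Real.one_le_exp (by linarith [hS₀ n])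
  have hx₀ : ∀ n, 0 ≤ x n := fun n => zero_le_one.trans (hx₁ n)
  have hsum₀ : ∀ k, 0 ≤ ∑ j ∈ Finset.range k, x j := fun k => Finset.sum_nonneg fun j _ => hx₀ j
  have hb₂ : ∀ k, 2 ^ k ≤ b k := fun k =>
    le_mul_of_one_le_right (by positivity) (by linarith [hsum₀ k])
  have hb₁ : ∀ k, 1 ≤ b k := fun k => (one_le_pow₀ one_le_two).trans (hb₂ k)
  have hbx : ∀ n k, n < k → x n / b k ≤ (1 / 2) ^ k := by
    intro n k hnk
    have h₁ : x n ≤ ∑ j ∈ Finset.range k, x j :=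
      Finset.single_le_sum (fun j _ => hx₀ j) (Finset.mem_range.2 hnk)
    rw [div_le_iff₀ (by linarith [hb₁ k])]
    simp only [b]
    rw [← mul_assoc, ← mul_pow]
    norm_num
    linarith
  have hs : Summable fun k => 1 / b k := by
    refine Summable.of_nonneg_of_le (fun k => by have := hb₁ k; positivity) (fun k => ?_)
      summable_geometric_two
    rw [one_div_pow]
    exact one_div_le_one_div_of_le (by positivity) (hb₂ k)
  have hlog : ∀ y, 0 ≤ y → ∀ k, 0 ≤ Real.log (1 + y / b k) ∧ Real.log (1 + y / b k) ≤ y / b k := by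
    intro y hy k
    have h : 0 ≤ y / b k := div_nonneg hy (by linarith [hb₁ k])
    refine ⟨Real.log_nonneg (by linarith), ?_⟩
    have := Real.log_le_sub_one_of_pos (show 0 < 1 + y / b k by linarith)
    linarith
  have hsl : ∀ y, 0 ≤ y → Summable fun k => Real.log (1 + y / b k) := fun y hy =>
    Summable.of_nonneg_of_le (fun k => (hlog y hy k).1)
      (fun k => (hlog y hy k).2.trans_eq (mul_one_div y (b k)).symm) (hs.mul_left y)
  have hlogx : ∀ n, Real.log (x n) = S n + 1 := fun n => Real.log_exp _
  have hlog2 : Real.log 2 ≤ 1 := by linarith [Real.log_two_lt_d9]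
  have hb₀ : b 0 = 1 := by simp [b]
  have hlower : ∀ n, S n ≤ ∑' k, Real.log (1 + x n / b k) - ∑' k, Real.log (1 + 1 / b k) := by
    intro n
    rw [← (hsl _ (hx₀ n)).tsum_sub (hsl _ zero_le_one)]
    refine le_trans ?_ (((hsl _ (hx₀ n)).sub (hsl _ zero_le_one)).le_tsum 0 fun k _ => ?_)
    · rw [hb₀, div_one, div_one, one_add_one_eq_two]
      have : Real.log (x n) ≤ Real.log (1 + x n) :=
        Real.log_le_log (by linarith [hx₁ n]) (by linarith)
      linarith [hlogx n]
    · have hk := hb₁ k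
      have := hx₁ n
      rw [sub_nonneg]
      refine Real.log_le_log (by positivity) ?_
      gcongr
  have hupper : ∀ n : ℕ, ∑' k, Real.log (1 + x n / b k) ≤ 2 * (n + 2) * Real.log (x n) := by
    intro n
    -- The `n + 1` terms with `k ≤ n` are at most `log (2 * x n) ≤ 2 * log (x n)`; the remaining
    -- ones are dominated by a geometric series.
    have hterm : ∀ k, Real.log (1 + x n / b k) ≤
        (if k ∈ Finset.range (n + 1) then 2 * Real.log (x n) else 0) + (1 / 2) ^ k := by
      intro k
      split_ifs with hk
      · have h₁ : x n / b k ≤ x n := div_le_self (hx₀ n) (hb₁ k)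
        have h₂ : Real.log (1 + x n / b k) ≤ Real.log (2 * x n) :=
          Real.log_le_log (by have := hx₀ n; have := hb₁ k; positivity) (by linarith [hx₁ n])
        rw [Real.log_mul two_ne_zero (by linarith [hx₁ n])] at h₂
        have : (0 : ℝ) ≤ (1 / 2) ^ k := by positivity
        linarith [hlogx n, hS₀ n]
      · rw [zero_add]
        exact (hlog _ (hx₀ n) k).2.trans (hbx n k (by simpa using hk))
    have hfin : HasSum (fun k => if k ∈ Finset.range (n + 1) then 2 * Real.log (x n) else 0)
        (∑ k ∈ Finset.range (n + 1), 2 * Real.log (x n)) := by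
      convert hasSum_sum_of_ne_finset_zero (s := Finset.range (n + 1)) (L := .unconditional ℕ)
        (f := fun k => if k ∈ Finset.range (n + 1) then 2 * Real.log (x n) else 0)
        (fun k hk => if_neg hk) using 1
      exact Finset.sum_congr rfl fun k hk => (if_pos hk).symm
    have := hasSum_le hterm (hsl _ (hx₀ n)).hasSum (hfin.add hasSum_geometric_two)
    rw [Finset.sum_const, Finset.card_range, nsmul_eq_mul] at this
    push_cast at this
    nlinarith [hlogx n, hS₀ n]
  refine ⟨b, x, hb₁, hs, hb₀, hx₁, ?_, ?_⟩
  · refine tendsto_atTop_mono (fun n => ?_) tendsto_natCast_atTop_atTop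
    linarith [hlower n, hS₁ n]
  · rintro n t rfl
    obtain ⟨h₁, h₂⟩ := hS₂ n _ (hlower n)
    refine ⟨h₁, ?_⟩
    have h₃ : 0 ≤ ∑' k, Real.log (1 + 1 / b k) := tsum_nonneg fun k => (hlog 1 zero_le_one k).1
    have h₄ := hupper n
    set t := ∑' k, Real.log (1 + x n / b k) - ∑' k, Real.log (1 + 1 / b k)
    have hn : (0 : ℝ) < n + 2 := by positivity
    calc (n + 2) / 4 * g t ≤ (n + 2) / 4 * (2 * (n + 2) * Real.log (x n) / (n + 2 : ℝ) ^ 2) := by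
          refine mul_le_mul_of_nonneg_left (h₂.trans ?_) (by positivity)
          gcongr
          linarith
      _ = Real.log (x n) / 2 := by field_simp; norm_num

/-! ### The translated images fill the plane -/

/-- The crude bound `‖z‖ ≤ re + im ≤ 2 * im` suffices: only a positive constant is needed. -/
theorem arcsin_half_le_arg {z : ℂ} (h₀ : 0 < z.re) (h₁ : z.re ≤ z.im) :
    Real.arcsin (1 / 2) ≤ z.arg := by
  rw [Complex.arg_of_re_nonneg h₀.le]
  refine Real.arcsin_le_arcsin ?_
  have hz : 0 < ‖z‖ := h₀.trans_le ((le_abs_self _).trans (Complex.abs_re_le_norm z))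
  have h₂ := Complex.norm_le_abs_re_add_abs_im z
  rw [abs_of_pos h₀, abs_of_pos (h₀.trans_le h₁)] at h₂
  rw [div_le_div_iff₀ two_pos hz]
  linarith

theorem exists_le_im_logSeries {b : ℕ → ℝ} (hb : ∀ k, 1 ≤ b k) (hs : Summable fun k => 1 / b k)
    (C : ℝ) : ∃ w ∈ rightHalfPlane, C ≤ (logSeries b w).im := by
  have hc : 0 < Real.arcsin (1 / 2) := Real.arcsin_pos.2 (by norm_num)
  obtain ⟨n, hn⟩ := exists_nat_ge (C / Real.arcsin (1 / 2))
  -- At `1 + i y`, each of the first `n` factors has imaginary part at least its real part, as `y ≥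
  -- 1 + b k`; the remaining arguments are nonnegative.
  let y : ℝ := 1 + ∑ k ∈ Finset.range n, b k
  have hy : ∀ k ∈ Finset.range n, 1 + b k ≤ y := fun k hk => by
    have := Finset.single_le_sum (f := b) (fun j _ => zero_le_one.trans (hb j)) hk
    simp only [y]
    linarith
  have hy₀ : 0 ≤ y := add_nonneg zero_le_one
    (Finset.sum_nonneg fun j _ => zero_le_one.trans (hb j))
  let w : ℂ := ⟨1, y⟩
  have hw : w ∈ rightHalfPlane := show (0 : ℝ) < 1 from one_pos
  have hre : ∀ k, (1 + w / b k).re = 1 + 1 / b k := fun k => by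
    simp [w, Complex.div_ofReal_re]
  have him : ∀ k, (1 + w / b k).im = y / b k := fun k => by
    simp [w, Complex.div_ofReal_im]
  have hsum := summable_complex_log hb hs hw
  refine ⟨w, hw, ?_⟩
  rw [logSeries, Complex.im_tsum hsum]
  simp only [Complex.log_im]
  have hsum' : Summable fun k => (1 + w / b k).arg := by
    simpa only [Complex.imCLM_apply, Complex.log_im] using Complex.imCLM.summable hsum
  calc C ≤ n * Real.arcsin (1 / 2) := (div_le_iff₀ hc).1 hn
    _ = ∑ k ∈ Finset.range n, Real.arcsin (1 / 2) := by simp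
    _ ≤ ∑ k ∈ Finset.range n, (1 + w / b k).arg := by
      refine Finset.sum_le_sum fun k hk => arcsin_half_le_arg ?_ ?_
      · linarith [one_le_re_one_add_div (hb k) hw]
      · have hbk : 0 < b k := by linarith [hb k]
        rw [hre, him, le_div_iff₀ hbk, add_mul, one_div_mul_cancel hbk.ne']
        linarith [hy k hk]
    _ ≤ ∑' k, (1 + w / b k).arg := by
      refine hsum'.sum_le_tsum _ fun k _ => Complex.arg_nonneg_iff.2 ?_
      rw [him]
      exact div_nonneg hy₀ (zero_le_one.trans (hb k))

theorem logSeries_conj {b : ℕ → ℝ} (hb : ∀ k, 1 ≤ b k) {w : ℂ} (hw : w ∈ rightHalfPlane) :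
    logSeries b (starRingEnd ℂ w) = starRingEnd ℂ (logSeries b w) := by
  rw [logSeries, logSeries, Complex.conj_tsum]
  refine tsum_congr fun k => ?_
  rw [← Complex.log_conj]
  · simp
  · exact (Complex.mem_slitPlane_iff_arg.1
      (Or.inl (by linarith [one_le_re_one_add_div (hb k) hw]))).1

/-- Nonnegative values come from the intermediate value theorem on the connected half-plane,
starting from `Im F(1) = 0`; negative ones by conjugation. -/
theorem exists_im_logSeries_eq {b : ℕ → ℝ} (hb : ∀ k, 1 ≤ b k) (hs : Summable fun k => 1 / b k)
    (η : ℝ) : ∃ w ∈ rightHalfPlane, (logSeries b w).im = η := by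
  have hpos : ∀ η : ℝ, 0 ≤ η → ∃ w ∈ rightHalfPlane, (logSeries b w).im = η := by
    intro η hη
    obtain ⟨w, hw, hw'⟩ := exists_le_im_logSeries hb hs η
    have h₁ : (1 : ℂ) ∈ rightHalfPlane := show (0 : ℝ) < 1 from one_pos
    have h₂ : (logSeries b 1).im = 0 := by
      have := logSeries_ofReal hb zero_le_one
      rw [Complex.ofReal_one] at this
      rw [this, Complex.ofReal_im]
    have hcont : ContinuousOn (fun w => (logSeries b w).im) rightHalfPlane := fun w hw =>
      (Complex.continuous_im.continuousAt.comp
        (hasDerivAt_logSeries hb hs hw).continuousAt).continuousWithinAt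
    exact convex_rightHalfPlane.isPreconnected.intermediate_value h₁ hw hcont ⟨h₂.trans_le hη, hw'⟩
  rcases le_total 0 η with hη | hη
  · exact hpos η hη
  · obtain ⟨w, hw, hw'⟩ := hpos (-η) (by linarith)
    refine ⟨starRingEnd ℂ w, by simpa [rightHalfPlane] using hw, ?_⟩
    rw [logSeries_conj hb hw, Complex.conj_im, hw', neg_neg]

theorem exists_add_mem_image_logSeries {b : ℕ → ℝ} (hb : ∀ k, 1 ≤ b k)
    (hs : Summable fun k => 1 / b k) (hb₀ : b 0 = 1) (ζ : ℂ) :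
    ∃ t : ℝ, 0 ≤ t ∧ ζ + t ∈ logSeries b '' rightHalfPlane := by
  obtain ⟨w, hw, hw'⟩ := exists_im_logSeries_eq hb hs ζ.im
  rcases le_total ζ.re (logSeries b w).re with h | h
  · refine ⟨(logSeries b w).re - ζ.re, sub_nonneg.2 h, w, hw, ?_⟩
    apply Complex.ext <;> simp [hw']
  · refine ⟨0, le_rfl, ?_⟩
    convert logSeries_add_mem_image hb hs hb₀ hw (sub_nonneg.2 h) using 1
    apply Complex.ext <;> simp [hw']

/-! ### Transport to the disc -/

/-- The Cayley transform from the unit disc to the right half-plane. -/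
noncomputable def discToHalfPlane (z : ℂ) : ℂ := (1 + z) / (1 - z)

theorem one_sub_ne_zero_of_mem_ball {z : ℂ} (hz : z ∈ ball (0 : ℂ) 1) : 1 - z ≠ 0 := by
  intro h
  rw [← sub_eq_zero.1 h] at hz
  simp at hz

theorem mem_ball_iff_discToHalfPlane_mem {z : ℂ} (hz : 1 - z ≠ 0) :
    z ∈ ball (0 : ℂ) 1 ↔ discToHalfPlane z ∈ rightHalfPlane := by
  have h : 0 < Complex.normSq (1 - z) := Complex.normSq_pos.2 hz
  have h₁ : (discToHalfPlane z).re = (1 - Complex.normSq z) / Complex.normSq (1 - z) := by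
    rw [discToHalfPlane, Complex.div_re, ← add_div]
    congr 1
    simp [Complex.normSq_apply]
    ring
  rw [rightHalfPlane, mem_ofPred_eq, h₁, div_pos_iff_of_pos_right h, sub_pos, mem_ball_zero_iff,
    Complex.normSq_eq_norm_sq, sq_lt_one_iff₀ (norm_nonneg z)]

theorem discToHalfPlane_mem {z : ℂ} (hz : z ∈ ball (0 : ℂ) 1) :
    discToHalfPlane z ∈ rightHalfPlane :=
  (mem_ball_iff_discToHalfPlane_mem (one_sub_ne_zero_of_mem_ball hz)).1 hz

theorem exists_discToHalfPlane_eq {w : ℂ} (hw : w ∈ rightHalfPlane) :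
    (w - 1) / (w + 1) ∈ ball (0 : ℂ) 1 ∧ discToHalfPlane ((w - 1) / (w + 1)) = w := by
  have h : w + 1 ≠ 0 := fun h => by
    have h₁ := congrArg Complex.re h
    have h₂ : 0 < w.re := hw
    simp at h₁
    linarith
  have h₁ : 1 - (w - 1) / (w + 1) = 2 / (w + 1) := by field_simp; ring
  have h₂ : discToHalfPlane ((w - 1) / (w + 1)) = w := by
    rw [discToHalfPlane, h₁]
    field_simp
    ring
  refine ⟨?_, h₂⟩
  rw [mem_ball_iff_discToHalfPlane_mem (h₁ ▸ div_ne_zero two_ne_zero h), h₂]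
  exact hw

theorem image_discToHalfPlane : discToHalfPlane '' ball (0 : ℂ) 1 = rightHalfPlane := by
  ext w
  refine ⟨?_, fun hw => ⟨_, exists_discToHalfPlane_eq hw⟩⟩
  rintro ⟨z, hz, rfl⟩
  exact discToHalfPlane_mem hz

theorem hasDerivAt_discToHalfPlane {z : ℂ} (hz : z ∈ ball (0 : ℂ) 1) :
    HasDerivAt discToHalfPlane (2 / (1 - z) ^ 2) z := by
  have h := one_sub_ne_zero_of_mem_ball hz
  refine (((hasDerivAt_id z).const_add 1).div ((hasDerivAt_id z).const_sub 1) h).congr_deriv ?_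
  simp only [id]
  congr 1
  ring

theorem injOn_discToHalfPlane : InjOn discToHalfPlane (ball (0 : ℂ) 1) := by
  intro z hz w hw h
  rw [discToHalfPlane, discToHalfPlane, div_eq_div_iff (one_sub_ne_zero_of_mem_ball hz)
    (one_sub_ne_zero_of_mem_ball hw)] at h
  linear_combination h / 2

/-- The Koenigs function `i ∑ log (1 + w / bₖ)`, transported to the unit disc. -/
noncomputable def logKoenigs (b : ℕ → ℝ) (z : ℂ) : ℂ :=
  Complex.I * logSeries b (discToHalfPlane z)

theorem image_logKoenigs (b : ℕ → ℝ) : logKoenigs b '' ball (0 : ℂ) 1 =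
    (fun w => Complex.I * w) '' (logSeries b '' rightHalfPlane) := by
  rw [← image_discToHalfPlane, image_image, image_image]
  rfl

theorem isKoenigsMap_logKoenigs {b : ℕ → ℝ} (hb : ∀ k, 1 ≤ b k) (hs : Summable fun k => 1 / b k)
    (hb₀ : b 0 = 1) : IsKoenigsMap (logKoenigs b) := by
  have hder : ∀ z ∈ ball (0 : ℂ) 1, HasDerivAt (logKoenigs b) (Complex.I *
      ((∑' k, ((b k : ℂ) + discToHalfPlane z)⁻¹) * (2 / (1 - z) ^ 2))) z := fun z hz =>
    ((hasDerivAt_logSeries hb hs (discToHalfPlane_mem hz)).comp z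
      (hasDerivAt_discToHalfPlane hz)).const_mul Complex.I
  refine ⟨fun z hz => (hder z hz).differentiableAt.differentiableWithinAt, ?_, fun z hz => ?_, ?_⟩
  · intro z hz w hw h
    exact injOn_discToHalfPlane hz hw (injOn_logSeries hb hs (discToHalfPlane_mem hz)
      (discToHalfPlane_mem hw) (mul_left_cancel₀ Complex.I_ne_zero h))
  · rw [(hder z hz).deriv]
    have h₁ : (∑' k, ((b k : ℂ) + discToHalfPlane z)⁻¹) ≠ 0 := fun h => by
      simpa [h] using re_deriv_logSeries_pos hb hs (discToHalfPlane_mem hz)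
    exact mul_ne_zero Complex.I_ne_zero (mul_ne_zero h₁
      (div_ne_zero two_ne_zero (pow_ne_zero 2 (one_sub_ne_zero_of_mem_ball hz))))
  · rw [image_logKoenigs]
    rintro t ht _ ⟨_, ⟨w, hw, rfl⟩, rfl⟩
    exact ⟨_, logSeries_add_mem_image hb hs hb₀ hw ht, mul_add _ _ _⟩

theorem exists_add_mem_image_logKoenigs {b : ℕ → ℝ} (hb : ∀ k, 1 ≤ b k)
    (hs : Summable fun k => 1 / b k) (hb₀ : b 0 = 1) (ζ : ℂ) :
    ∃ t : ℝ, 0 ≤ t ∧ ζ + Complex.I * t ∈ logKoenigs b '' ball (0 : ℂ) 1 := by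
  obtain ⟨t, ht, h⟩ := exists_add_mem_image_logSeries hb hs hb₀ (-Complex.I * ζ)
  refine ⟨t, ht, ?_⟩
  rw [image_logKoenigs]
  refine ⟨_, h, ?_⟩
  linear_combination (-ζ) * Complex.I_sq

/-! ### Total speed and conclusion -/

/-- The Cayley transform sends `0` to `1`, so at time `t` the orbit sits at the point over `x`,
namely `(x - 1) / (x + 1)`, whose `artanh` is `log x / 2`. -/
theorem half_log_le_totalSpeed {b : ℕ → ℝ} (hb : ∀ k, 1 ≤ b k) (hs : Summable fun k => 1 / b k)
    (hb₀ : b 0 = 1) {x t : ℝ} (hx : 0 < x)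
    (ht : t = ∑' k, Real.log (1 + x / b k) - ∑' k, Real.log (1 + 1 / b k)) :
    Real.log x / 2 ≤ totalSpeed (translationSemigroup (logKoenigs b)) t := by
  have hx' : (x : ℂ) ∈ rightHalfPlane := by simpa [rightHalfPlane] using hx
  obtain ⟨h₁, h₂⟩ := exists_discToHalfPlane_eq hx'
  have h₃ : translationSemigroup (logKoenigs b) t 0 = ((x : ℂ) - 1) / (x + 1) := by
    refine (isKoenigsMap_logKoenigs hb hs hb₀).translationSemigroup_eq h₁ ?_
    have h₄ : discToHalfPlane 0 = ((1 : ℝ) : ℂ) := by simp [discToHalfPlane]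
    rw [logKoenigs, logKoenigs, h₂, h₄, logSeries_ofReal hb hx.le,
      logSeries_ofReal hb zero_le_one, ht]
    push_cast
    ring
  have h₅ : ((x : ℂ) - 1) / (x + 1) = (((x - 1) / (x + 1) : ℝ) : ℂ) := by push_cast; rfl
  rw [totalSpeed, h₃]
  refine le_trans (le_of_eq ?_) (le_hyperbolicDist (mem_ball_self one_pos) h₁)
  have h₆ : x + 1 ≠ 0 := by linarith
  have h₇ : 1 + (x - 1) / (x + 1) = x * (2 / (x + 1)) := by field_simp; ring
  have h₈ : 1 - (x - 1) / (x + 1) = 2 / (x + 1) := by field_simp; ring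
  rw [h₅, Complex.ofReal_re, h₇, h₈, Real.log_mul hx.ne' (by positivity)]
  simp

theorem mainTheorem8 (g : ℝ → ℝ) (hg_nonneg : ∀ t, 0 ≤ t → 0 ≤ g t)
    (hg_atTop : Tendsto g atTop atTop)
    (hg_div : Tendsto (fun t => g t / t) atTop (𝓝 0)) :
    ∃ φ : ℝ → ℂ → ℂ, IsParabolicSemigroup φ ∧ HasZeroHyperbolicStep φ ∧
      limsup (fun t : ℝ => ((totalSpeed φ t / g t : ℝ) : EReal)) atTop = ⊤ := by
  obtain ⟨b, x, hb, hs, hb₀, hx, htend, hbound⟩ := exists_slow_log_series hg_atTop hg_div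
  have hK := isKoenigsMap_logKoenigs hb hs hb₀
  have hbase := exists_add_mem_image_logKoenigs hb hs hb₀
  refine ⟨translationSemigroup (logKoenigs b), hK.isParabolicSemigroup hbase,
    ⟨_, hK.isHolomorphicModel hbase⟩, ?_⟩
  rw [EReal.eq_top_iff_forall_lt]
  intro C
  refine (EReal.coe_lt_coe_iff.2 (lt_add_one C)).trans_le (le_limsup_of_frequently_le ?_)
  -- The times attached to `x n` tend to infinity, so a bound along them holds frequently in `t`.
  refine htend.frequently (Eventually.frequently ?_)
  -- For `n ≥ N` the ratio is at least `(n + 2) / 4 ≥ C + 1`.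
  obtain ⟨N, hN⟩ := exists_nat_ge (4 * (C + 1))
  filter_upwards [eventually_ge_atTop N] with n hn
  obtain ⟨h₁, h₂⟩ := hbound n _ rfl
  have h₃ := half_log_le_totalSpeed hb hs hb₀ (zero_lt_one.trans_le (hx n)) rfl
  rw [EReal.coe_le_coe_iff, le_div_iff₀ h₁]
  refine le_trans ?_ (h₂.trans h₃)
  refine mul_le_mul_of_nonneg_right ?_ h₁.le
  have : (N : ℝ) ≤ n := Nat.cast_le.2 hn
  linarith
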